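/- **Setting.** Let $V$ and $H=H'$ be real separable Hilbert spaces with $V\subseteq H$ densely, continuously and compactly, so that $V\subset H\subset V'$. Write $\mathbb N_+=\{1,2,\dots\}$ and $\overline{\mathbb R}_+=[0,\infty)$. Assume the following. 1. $A\in\mathcal L(V,V')$ is symmetric and $(y,z)\mapsto\langle Ay,z\rangle_{V',V}$ is a complete scalar product on $V$. 2. $A_{\rm rc}\in L^\infty\bigl((0,\infty);\mathcal L(H,V')+\mathcal L(V,H)\bigr)$, with measurability in the weak sense that $t\mapsto\langle A_{\rm rc}(t)v,w\rangle_{V',V}$ is measurable for all $v,w\in V$. 3. For $M,S\in\mathbb N_+$ let $\Phi^M_1,\dots,\Phi^M_{\sigma(M)}\in H$ (actuators) and $\Psi^S_1,\dots,\Psi^S_{\varsigma(S)}\in H$ (sensors) be finite families, and put $U_M^\diamond v=\sum_j v_j\Phi_j^M$ and $W_S^\vee h=\bigl((\Psi^S_i,h)_H\bigr)_i$. For $\lambda\ge0$ let $K_M^{[\lambda]}\in\mathcal L(H,\mathbb R^{\sigma(M)})$ and $L_S^{[\lambda]}\in\mathcal L(\mathbb R^{\varsigma(S)},V')$. For every $\varrho>0$: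 (a) there is $M_*\in\mathbb N_+$ such that for all $M\ge M_*$ there is $\lambda_{1*}\in\overline{\mathbb R}_+$ such that for all $\lambda_1\ge\lambda_{1*}$ and $w\in V$, $2\langle(A-U_M^\diamond K_M^{[\lambda_1]})w,w\rangle_{V',V}\ge\|w\|_V^2+\varrho\|w\|_H^2$; (b) there is $S_*\in\mathbb N_+$ such that for all $S\ge S_*$ there is $\lambda_{2*}\in\overline{\mathbb R}_+$ such that for all $\lambda_2\ge\lambda_{2*}$ and $w\in V$, $2\langle(A-L_S^{[\lambda_2]}W_S^\vee)w,w\rangle_{V',V}\ge\|w\|_V^2+\varrho\|w\|_H^2$. 4. $\mathcal A_{\rm m}$ maps functions $g:(0,\infty)\to V$ to functions $\mathcal A_{\rm m}[g]:(0,\infty)\to V'$, where $\mathcal A_{\rm m}[g](t)$ depends only on $g|_{(0,t)}$ (up to null sets), and $\int_0^t\langle\mathcal A_{\rm m}[g](s),g(s)\rangle_{V',V}\,ds\ge0$ for all $t>0$ and $g\in L^2(0,t;V)$. Let $\eta\ge0$ and consider, for $(z_0,y_0)\in H\times H$, the system $$\dot z=-Az-A_{\rm rc}z-\eta\mathcal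 A_{\rm m}[z]+L_S^{[\lambda_2]}W_S^\vee z,\qquad z(0)=z_0,$$ $$\dot y=-Ay-A_{\rm rc}y-\eta\mathcal A_{\rm m}[y]+U_M^\diamond K_M^{[\lambda_1]}y+U_M^\diamond K_M^{[\lambda_1]}z,\qquad y(0)=y_0.$$ A weak solution is a pair $z,y\in C([0,\infty);H)\cap L^2_{\rm loc}([0,\infty);V)$ with weak derivatives $\dot z,\dot y\in L^2_{\rm loc}([0,\infty);V')$ which satisfies these equations. Write $\|(z,y)\|^2=\|z\|_H^2+\|y\|_H^2$. **Theorem.** There are $M_*,S_*\in\mathbb N_+$ such that the following hold. (i) There are $\lambda_{1*}(M),\lambda_{2*}(S)\in\overline{\mathbb R}_+$, depending only on $M$ and only on $S$ respectively, such that for all $M\ge M_*$, $S\ge S_*$, $\lambda_1\ge\lambda_{1*}(M)$, $\lambda_2\ge\lambda_{2*}(S)$ there is a constant $D_1\ge0$ such that for all $(z_0,y_0)\in H\times H$ each weak solution satisfies $$\|(z,y)(t)\|^2+\mathfrak M(t)\le(1+D_1)\bigl(\|(z,y)(s)\|^2+\mathfrak M(s)\bigr)\qquad(0\le s\le t),$$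 where $\mathfrak M=\mathfrak M_z+\mathfrak M_y$ and, for $g\in\{z,y\}$, $\mathfrak M_g(t)=2\eta\int_0^t\langle\mathcal A_{\rm m}[g](\tau),g(\tau)\rangle_{V',V}\,d\tau\ge0$, the function $\eta\langle\mathcal A_{\rm m}[g],g\rangle_{V',V}$ being integrable on $(0,t)$. (ii) Suppose in addition that $\mathcal A_{\rm m}[g](t)=\int_0^t e^{-\gamma(t-s)}Bg(s)\,ds$ for $t>0$ and $g\in L^2(0,t;V)$, where $\gamma>0$ and $B\in\mathcal L(V,V')$ is symmetric with $\langle Bv,v\rangle_{V',V}\ge0$ for all $v\in V$ (for instance $B=-\Delta$ or $B=A$). Then there are $M_*'\ge M_*$ and $S_*'\ge S_*$ and, again, $\lambda_{1*}(M)$ and $\lambda_{2*}(S)$ such that for all $M\ge M_*'$, $S\ge S_*'$, $\lambda_1\ge\lambda_{1*}(M)$, $\lambda_2\ge\lambda_{2*}(S)$ there is $D_1\ge0$ such that for all $(z_0,y_0)\in H\times H$ each weak solution satisfies the conclusions of (i) and $$e^{2\gamma t}\|(z,y)(t)\|^2+\overline{\mathfrak M}(t)\le(1+D_1)\bigl(e^{2\gamma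 s}\|(z,y)(s)\|^2+\overline{\mathfrak M}(s)\bigr)\qquad(0\le s\le t),$$ where $\overline{\mathfrak M}=\overline{\mathfrak M}_z+\overline{\mathfrak M}_y$ and, for $g\in\{z,y\}$, $$\overline{\mathfrak M}_g(t)=2\eta\int_0^t\Bigl\langle\int_0^\tau B\bigl(e^{\gamma s}g(s)\bigr)\,ds,\;e^{\gamma\tau}g(\tau)\Bigr\rangle_{V',V}d\tau\ge0,$$ the outer integrand being integrable on $(0,t)$. In particular $\|(z,y)(t)\|^2\le(1+D_1)e^{-2\gamma t}\|(z_0,y_0)\|^2$ for $t\ge0$: the system is exponentially stable with rate $\gamma$. -/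

import Mathlib

open scoped NNReal

noncomputable section

namespace MemoryStab

open MeasureTheory Set Filter Topology

variable {V H : Type*}
  [NormedAddCommGroup V] [InnerProductSpace ℝ V]
  [NormedAddCommGroup H] [InnerProductSpace ℝ H]

/-- The inclusion `V ⊆ H`, written as a bounded linear map `ι : V → H`, is injective, dense and
compact. -/
structure IsGelfandInclusion (ι : V →L[ℝ] H) : Prop where
  injective : Function.Injective ι
  dense : DenseRange ι
  compact : IsCompactOperator ι

/-- The inclusion `H = H' ⊆ V'`: the functional `v ↦ (h, v)_H`. -/
def pivot (ι : V →L[ℝ] H) (h : H) : StrongDual ℝ V :=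
  (innerSL ℝ h).comp ι

/-- `A ∈ L(V, V')` is symmetric and `(y, z) ↦ ⟨A y, z⟩` is a complete scalar product on `V`:
it is positive definite and each sequence which is Cauchy for its norm converges for its norm. -/
structure IsCompleteScalarProduct (A : V →L[ℝ] StrongDual ℝ V) : Prop where
  symm : ∀ v w, A v w = A w v
  pos : ∀ v, v ≠ 0 → 0 < A v v
  complete : ∀ u : ℕ → V,
    (∀ ε > 0, ∃ N, ∀ m ≥ N, ∀ n ≥ N, A (u m - u n) (u m - u n) < ε) →
      ∃ v, Tendsto (fun n => A (u n - v) (u n - v)) atTop (𝓝 0)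

/-- `A_rc ∈ L^∞((0,∞); L(H,V') + L(V,H))`. The norm of the sum space is the infimum of
`‖B₁‖ + ‖B₂‖` over the decompositions `B₁ + B₂`, so that finiteness of the essential supremum is
the existence of a constant `C` below. Measurability in time is only required in the weak sense. -/
structure IsBoundedReactionConvection (ι : V →L[ℝ] H) (Arc : ℝ → V →L[ℝ] StrongDual ℝ V) :
    Prop where
  measurable : ∀ v w, AEStronglyMeasurable (fun t => Arc t v w) (volume.restrict (Ioi 0))
  bounded : ∃ C : ℝ, ∀ᵐ t ∂(volume.restrict (Ioi (0 : ℝ))),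
    ∃ (B₁ : H →L[ℝ] StrongDual ℝ V) (B₂ : V →L[ℝ] H),
      (∀ v, Arc t v = B₁ (ι v) + pivot ι (B₂ v)) ∧ ‖B₁‖ + ‖B₂‖ ≤ C

/-- The control operator `v ↦ ∑ⱼ vⱼ Φⱼ` of a finite family of actuators `Φⱼ ∈ H`. -/
def inputOp {m : ℕ} (Φ : Fin m → H) : EuclideanSpace ℝ (Fin m) →L[ℝ] H :=
  ∑ j, (EuclideanSpace.proj j : EuclideanSpace ℝ (Fin m) →L[ℝ] ℝ).smulRight (Φ j)

theorem inputOp_apply {m : ℕ} (Φ : Fin m → H) (v : EuclideanSpace ℝ (Fin m)) :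
    inputOp Φ v = ∑ j, v j • Φ j := by
  simp [inputOp]

/-- The output operator `h ↦ ((Ψᵢ, h)_H)ᵢ` of a finite family of sensors `Ψᵢ ∈ H`. -/
def outputOp {n : ℕ} (Ψ : Fin n → H) : H →L[ℝ] EuclideanSpace ℝ (Fin n) :=
  ((EuclideanSpace.equiv (Fin n) ℝ).symm.toContinuousLinearMap).comp
    (ContinuousLinearMap.pi fun i => innerSL ℝ (Ψ i))

theorem outputOp_apply {n : ℕ} (Ψ : Fin n → H) (h : H) (i : Fin n) :
    outputOp Ψ h i = inner ℝ (Ψ i) h := by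
  simp [outputOp]

/-- Coercivity of `A - P_N^{[λ]}` for a family `P_N^{[λ]} : V → V'`: for each `ϱ > 0`, for all
large `N` and, depending on `N`, all large gains `λ`,
`2 ⟨(A - P_N^{[λ]}) w, w⟩ ≥ ‖w‖_V² + ϱ ‖w‖_H²` on `V`. -/
def IsEventuallyCoercive (ι : V →L[ℝ] H) (A : V →L[ℝ] StrongDual ℝ V)
    (P : ℕ+ → ℝ≥0 → V → StrongDual ℝ V) : Prop :=
  ∀ ϱ : ℝ, 0 < ϱ → ∃ Ns : ℕ+, ∀ N ≥ Ns, ∃ ls : ℝ≥0, ∀ l ≥ ls, ∀ w : V,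
    ‖w‖ ^ 2 + ϱ * ‖ι w‖ ^ 2 ≤ 2 * (A w - P N l w) w

/-- An operator acting on histories: `g ↦ 𝒜[g]`, where `𝒜[g](t) ∈ V'` depends only on the
restriction of `g` to `(0, t)`, up to null sets. -/
structure HistoryOperator (V : Type*) [NormedAddCommGroup V] [InnerProductSpace ℝ V] where
  toFun : (ℝ → V) → ℝ → StrongDual ℝ V
  causal : ∀ (g g' : ℝ → V) (t : ℝ),
    (∀ᵐ s ∂(volume.restrict (Ioo 0 t)), g s = g' s) → toFun g t = toFun g' t

/-- Positivity of the memory operator: `∫₀ᵗ ⟨𝒜[g](s), g(s)⟩ ds ≥ 0` for `t > 0`, `g ∈ L²(0,t;V)`.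
(For a `g` such that the integrand is not integrable this says nothing.) -/
def IsPositiveMemory (Am : HistoryOperator V) : Prop :=
  ∀ t : ℝ, 0 < t → ∀ g : ℝ → V, MemLp g 2 (volume.restrict (Ioo 0 t)) →
    0 ≤ ∫ s in (0 : ℝ)..t, Am.toFun g s (g s)

/-- `𝒜[g](t) = ∫₀ᵗ e^{-γ (t - s)} B g(s) ds`, the memory operator with the exponential kernel and
the operator `B ∈ L(V, V')`. -/
def IsExponentialMemory (γ : ℝ) (B : V →L[ℝ] StrongDual ℝ V) (Am : HistoryOperator V) : Prop :=
  ∀ t : ℝ, 0 < t → ∀ g : ℝ → V, MemLp g 2 (volume.restrict (Ioo 0 t)) →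
    Am.toFun g t = ∫ s in (0 : ℝ)..t, Real.exp (-γ * (t - s)) • B (g s)

/-- The memory energy `𝔐_g(t) = 2η ∫₀ᵗ ⟨𝒜[g](τ), g(τ)⟩ dτ`. -/
def memoryEnergy (η : ℝ) (Am : HistoryOperator V) (g : ℝ → V) (t : ℝ) : ℝ :=
  2 * η * ∫ τ in (0 : ℝ)..t, Am.toFun g τ (g τ)

/-- The integrand `⟨∫₀^τ B (e^{γ s} g(s)) ds, e^{γ τ} g(τ)⟩` of the weighted memory energy. -/
def weightedPower (γ : ℝ) (B : V →L[ℝ] StrongDual ℝ V) (g : ℝ → V) (τ : ℝ) : ℝ :=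
  (∫ s in (0 : ℝ)..τ, B (Real.exp (γ * s) • g s)) (Real.exp (γ * τ) • g τ)

/-- The weighted memory energy
`2η ∫₀ᵗ ⟨∫₀^τ B (e^{γ s} g(s)) ds, e^{γ τ} g(τ)⟩ dτ`. -/
def weightedEnergy (η γ : ℝ) (B : V →L[ℝ] StrongDual ℝ V) (g : ℝ → V) (t : ℝ) : ℝ :=
  2 * η * ∫ τ in (0 : ℝ)..t, weightedPower γ B g τ

/-- Weak solutions of `ẏ = f`, `y(0) = y₀`: one has `y ∈ C([0,∞);H)`, `y = yV` almost everywhere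
with `yV ∈ L²_loc([0,∞);V)`, `f ∈ L²_loc([0,∞);V')`, and for each `v ∈ V` the function
`t ↦ (y(t), v)_H` is the primitive of `⟨f, v⟩` with the value `(y₀, v)_H` at time `0`; that is,
the weak derivative of `y` is `f`. -/
structure IsWeakPrimitive (ι : V →L[ℝ] H) (f : ℝ → StrongDual ℝ V) (y₀ : H)
    (y : ℝ → H) (yV : ℝ → V) : Prop where
  continuousOn : ContinuousOn y (Ici 0)
  init : y 0 = y₀
  ae_eq : ∀ᵐ t ∂(volume.restrict (Ioi 0)), ι (yV t) = y t
  memLp : ∀ T : ℝ, 0 < T → MemLp yV 2 (volume.restrict (Ioo 0 T))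
  memLp_deriv : ∀ T : ℝ, 0 < T → MemLp f 2 (volume.restrict (Ioo 0 T))
  weak : ∀ v : V, ∀ t : ℝ, 0 ≤ t →
    inner ℝ (y t) (ι v) = inner ℝ y₀ (ι v) + ∫ τ in (0 : ℝ)..t, f τ v

/-- Weak solutions `(z, y)` of the closed-loop system in error-state coordinates,
`ż = -A z - A_rc z - η 𝒜[z] + L W z`,  `z(0) = z₀`,
`ẏ = -A y - A_rc y - η 𝒜[y] + U K y + U K z`,  `y(0) = y₀`. -/
structure IsWeakSolution (ι : V →L[ℝ] H) (A : V →L[ℝ] StrongDual ℝ V)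
    (Arc : ℝ → V →L[ℝ] StrongDual ℝ V) (η : ℝ) (Am : HistoryOperator V)
    {m n : ℕ} (U : EuclideanSpace ℝ (Fin m) →L[ℝ] H) (K : H →L[ℝ] EuclideanSpace ℝ (Fin m))
    (W : H →L[ℝ] EuclideanSpace ℝ (Fin n)) (L : EuclideanSpace ℝ (Fin n) →L[ℝ] StrongDual ℝ V)
    (z₀ y₀ : H) (z y : ℝ → H) (zV yV : ℝ → V) : Prop where
  error : IsWeakPrimitive ι
    (fun t => -A (zV t) - Arc t (zV t) - η • Am.toFun zV t + L (W (z t))) z₀ z zV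
  state : IsWeakPrimitive ι
    (fun t => -A (yV t) - Arc t (yV t) - η • Am.toFun yV t
      + pivot ι (U (K (y t))) + pivot ι (U (K (z t)))) y₀ y yV

/-- The memory energies of `z` and `y` are well defined and nonnegative, and
`‖(z,y)(t)‖² + 𝔐(t) ≤ (1 + D) (‖(z,y)(s)‖² + 𝔐(s))` for `0 ≤ s ≤ t`, with `𝔐 = 𝔐_z + 𝔐_y`. -/
structure LyapunovEstimate (η : ℝ) (Am : HistoryOperator V) (D : ℝ)
    (z y : ℝ → H) (zV yV : ℝ → V) : Prop where
  integrable : ∀ t : ℝ, 0 ≤ t →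
    IntervalIntegrable (fun τ => η * Am.toFun zV τ (zV τ)) volume 0 t ∧
    IntervalIntegrable (fun τ => η * Am.toFun yV τ (yV τ)) volume 0 t
  nonneg : ∀ t : ℝ, 0 ≤ t → 0 ≤ memoryEnergy η Am zV t ∧ 0 ≤ memoryEnergy η Am yV t
  bound : ∀ s t : ℝ, 0 ≤ s → s ≤ t →
    (‖z t‖ ^ 2 + ‖y t‖ ^ 2) + (memoryEnergy η Am zV t + memoryEnergy η Am yV t)
      ≤ (1 + D) * ((‖z s‖ ^ 2 + ‖y s‖ ^ 2) + (memoryEnergy η Am zV s + memoryEnergy η Am yV s))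

/-- The weighted memory energies of `z` and `y` are well defined and nonnegative,
`e^{2γt} ‖(z,y)(t)‖² + 𝔐(t) ≤ (1 + D) (e^{2γs} ‖(z,y)(s)‖² + 𝔐(s))` for `0 ≤ s ≤ t`, where `𝔐` is
the sum of the weighted energies, and `‖(z,y)‖` decays exponentially with rate `γ`. -/
structure ExponentialEstimate (η γ : ℝ) (B : V →L[ℝ] StrongDual ℝ V) (D : ℝ)
    (z y : ℝ → H) (zV yV : ℝ → V) : Prop where
  integrable : ∀ t : ℝ, 0 ≤ t →
    IntervalIntegrable (weightedPower γ B zV) volume 0 t ∧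
    IntervalIntegrable (weightedPower γ B yV) volume 0 t
  nonneg : ∀ t : ℝ, 0 ≤ t → 0 ≤ weightedEnergy η γ B zV t ∧ 0 ≤ weightedEnergy η γ B yV t
  bound : ∀ s t : ℝ, 0 ≤ s → s ≤ t →
    Real.exp (2 * γ * t) * (‖z t‖ ^ 2 + ‖y t‖ ^ 2)
        + (weightedEnergy η γ B zV t + weightedEnergy η γ B yV t)
      ≤ (1 + D) * (Real.exp (2 * γ * s) * (‖z s‖ ^ 2 + ‖y s‖ ^ 2)
        + (weightedEnergy η γ B zV s + weightedEnergy η γ B yV s))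
  decay : ∀ t : ℝ, 0 ≤ t →
    ‖z t‖ ^ 2 + ‖y t‖ ^ 2 ≤ (1 + D) * Real.exp (-2 * γ * t) * (‖z 0‖ ^ 2 + ‖y 0‖ ^ 2)

end MemoryStab

end

namespace MemoryStab

open MeasureTheory Set Filter Topology
open scoped ENNReal

/-! ### Energy identity from increments, by translation in L² -/

section Energy

/-! Each equation is tested with its own solution. Let `C` bound the reaction-convection term and
let κ be the norm of the feedback operator on H. Coercivity with ϱ = C² + 1 + 2γ absorbs that term
by Young's inequality and leaves a decay margin 1 + 2γ in both equations. The observer error z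
enters the equation for y only through a coupling of size 2κ‖z‖‖y‖ ≤ κ²‖z‖² + ‖y‖², so the
functional (1 + κ²)‖z‖² + ‖y‖² is dissipated with the weight e^{2γt}
(`IsWeakSolution.weighted_dissipation`). The memory terms contribute increments of memory energies.
As these energies are nonnegative, the functional can be exchanged for the unweighted sum at the
cost of the factor 1 + κ². The choice γ = 0 gives (i). For (ii), the weight turns the exponential
kernel into the constant kernel B, whose energy is half the quadratic form of B at the primitive of
e^{γs}g(s).

The analytic core is the energy identity `IsWeakPrimitive.norm_sq_sub`. Testing the weak form over
(τ, τ + h) with the sum of the end values gives the increment of ‖y‖². Averaging in τ and letting h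
→ 0, with continuity of translations in L², yields the identity
(`sub_eq_two_mul_integral_of_increments`). The same lemma evaluates the energy of B. -/

theorem _root_.MeasureTheory.MemLp.exists_extension {X G : Type*} [MeasurableSpace X]
    [NormedAddCommGroup G] {μ : Measure X} {p : ℝ≥0∞} {s : Set X} {f : X → G}
    (hf : MemLp f p (μ.restrict s)) (hs : MeasurableSet s) :
    ∃ f' : X → G, MemLp f' p μ ∧ ∀ x ∈ s, f' x = f x :=
  ⟨s.indicator f, (memLp_indicator_iff_restrict hs).2 hf, fun _ hx => indicator_of_mem hx f⟩

variable {E : Type*} [NormedAddCommGroup E] [NormedSpace ℝ E]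

/-- The pairing of a translate of `F ∈ L²` with a translate of `Y ∈ L²` depends continuously on
the two shifts. -/
theorem continuous_setIntegral_translate {F : ℝ → StrongDual ℝ E} {Y : ℝ → E}
    (hF : MemLp F 2 volume) (hY : MemLp Y 2 volume) (s : Set ℝ) :
    Continuous fun p : ℝ × ℝ => ∫ τ in s, F (p.1 + τ) (Y (p.2 + τ) + Y τ) := by
  have : Fact ((2 : ℝ≥0∞) ≠ ∞) := ⟨by simp⟩
  let R₁ := LpToLpRestrictCLM ℝ (StrongDual ℝ E) ℝ volume 2 s
  let R₂ := LpToLpRestrictCLM ℝ E ℝ volume 2 s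
  let P := (ContinuousLinearMap.id ℝ (StrongDual ℝ E)).lpPairing (volume.restrict s) 2 2
  -- The integral is a bounded bilinear pairing of L² translates, and the translation action on L²
  -- is continuous because the exponent is finite.
  have key : ∀ p : ℝ × ℝ, ∫ τ in s, F (p.1 + τ) (Y (p.2 + τ) + Y τ)
      = P (R₁ (DomAddAct.mk p.1 +ᵥ hF.toLp F)) (R₂ ((DomAddAct.mk p.2 +ᵥ hY.toLp Y) + hY.toLp Y)) := by
    intro p
    rw [ContinuousLinearMap.lpPairing_eq_integral]
    apply integral_congr_ae
    have h1 : ∀ᵐ τ ∂volume, (DomAddAct.mk p.1 +ᵥ hF.toLp F : Lp _ 2 volume) τ = F (p.1 + τ) := by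
      rw [DomAddAct.mk_vadd_toLp]
      exact MemLp.coeFn_toLp _
    have h2 : ∀ᵐ τ ∂volume, ((DomAddAct.mk p.2 +ᵥ hY.toLp Y) + hY.toLp Y : Lp _ 2 volume) τ
        = Y (p.2 + τ) + Y τ := by
      rw [DomAddAct.mk_vadd_toLp]
      filter_upwards [Lp.coeFn_add ((hY.comp_measurePreserving
        (measurePreserving_vadd p.2 volume)).toLp (fun τ => Y (p.2 +ᵥ τ))) (hY.toLp Y),
        (hY.comp_measurePreserving (measurePreserving_vadd p.2 volume)).coeFn_toLp,
        hY.coeFn_toLp] with τ e1 e2 e3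
      rw [e1]
      exact congrArg₂ (· + ·) e2 e3
    filter_upwards [LpToLpRestrictCLM_coeFn ℝ s (DomAddAct.mk p.1 +ᵥ hF.toLp F : Lp _ 2 volume),
      LpToLpRestrictCLM_coeFn ℝ s ((DomAddAct.mk p.2 +ᵥ hY.toLp Y) + hY.toLp Y : Lp _ 2 volume),
      ae_restrict_of_ae h1, ae_restrict_of_ae h2] with τ e1 e2 e3 e4
    simp only [R₁, R₂, ContinuousLinearMap.id_apply]
    rw [e1, e2, e3, e4]
  simp_rw [key]
  have c1 : Continuous fun p : ℝ × ℝ => (DomAddAct.mk p.1 +ᵥ hF.toLp F : Lp _ 2 volume) :=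
    (DomAddAct.continuous_mk.comp continuous_fst).vadd continuous_const
  have c2 : Continuous fun p : ℝ × ℝ => (DomAddAct.mk p.2 +ᵥ hY.toLp Y : Lp _ 2 volume) :=
    (DomAddAct.continuous_mk.comp continuous_snd).vadd continuous_const
  exact (P.continuous.comp (R₁.continuous.comp c1)).clm_apply
    (R₂.continuous.comp (c2.add continuous_const))

/-- Fubini applies because the integrand is dominated by ‖F(θ + τ)‖² + ‖G(τ)‖², which is integrable
on the bounded box. For the first summand this uses that the shear (τ, θ) ↦ (τ, θ + τ) preserves
measure. -/
theorem intervalIntegral_swap_translate {F : ℝ → StrongDual ℝ E} {G : ℝ → E}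
    (hF : MemLp F 2 volume) (hG : MemLp G 2 volume) (a b h : ℝ) :
    ∫ τ in a..b, ∫ θ in (0 : ℝ)..h, F (θ + τ) (G τ)
      = ∫ θ in (0 : ℝ)..h, ∫ τ in a..b, F (θ + τ) (G τ) := by
  apply intervalIntegral_intervalIntegral_swap
  have hmp : MeasurePreserving (fun z : ℝ × ℝ => (z.1, z.2 + z.1))
      (volume.prod volume) (volume.prod volume) := by
    simpa only [add_comm] using measurePreserving_prod_add (volume : Measure ℝ) volume
  have hmF : AEStronglyMeasurable (fun z : ℝ × ℝ => F (z.2 + z.1)) (volume.prod volume) :=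
    (hF.1.comp_snd (μ := (volume : Measure ℝ))).comp_measurePreserving hmp
  have hmG : AEStronglyMeasurable (fun z : ℝ × ℝ => G z.1) (volume.prod volume) := hG.1.comp_fst
  have i1 : IntegrableOn (fun z : ℝ × ℝ => ‖F (z.2 + z.1)‖ ^ 2) (uIoc a b ×ˢ uIoc 0 h)
      (volume.prod volume) := by
    have : Integrable (fun z : ℝ × ℝ => (uIoc a b).indicator 1 z.1 * ‖F z.2‖ ^ 2)
        (volume.prod volume) :=
      ((integrable_indicator_iff measurableSet_uIoc).2
        (integrableOn_const (C := (1 : ℝ)) (by simp [uIoc]))).mul_prod (hF.integrable_norm_pow (by simp))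
    have := hmp.integrable_comp_of_integrable this
    refine (this.integrableOn (s := uIoc a b ×ˢ uIoc 0 h)).congr ?_
    filter_upwards [ae_restrict_mem (measurableSet_uIoc.prod measurableSet_uIoc)] with z hz
    simp [indicator_of_mem hz.1]
  have i2 : IntegrableOn (fun z : ℝ × ℝ => ‖G z.1‖ ^ 2) (uIoc a b ×ˢ uIoc 0 h)
      (volume.prod volume) := by
    have : Integrable (fun z : ℝ × ℝ => ‖G z.1‖ ^ 2 * (uIoc 0 h).indicator 1 z.2)
        (volume.prod volume) :=
      (hG.integrable_norm_pow (by simp)).mul_prod ((integrable_indicator_iff measurableSet_uIoc).2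
        (integrableOn_const (C := (1 : ℝ)) (by simp [uIoc])))
    refine (this.integrableOn (s := uIoc a b ×ˢ uIoc 0 h)).congr ?_
    filter_upwards [ae_restrict_mem (measurableSet_uIoc.prod measurableSet_uIoc)] with z hz
    simp [indicator_of_mem hz.2]
  refine Integrable.mono' (i1.add i2) ?_ (Eventually.of_forall fun z => ?_)
  · exact ((ContinuousLinearMap.id ℝ (StrongDual ℝ E)).aestronglyMeasurable_comp₂ hmF hmG).restrict
  · have := (F (z.2 + z.1)).le_opNorm (G z.1)
    simp only [Function.uncurry, Pi.add_apply]
    nlinarith [sq_nonneg (‖F (z.2 + z.1)‖ - ‖G z.1‖), sq_nonneg ‖F (z.2 + z.1)‖, sq_nonneg ‖G z.1‖]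

theorem tendsto_average_right {N : ℝ → ℝ} (hN : ContinuousOn N (Ici 0)) {a : ℝ} (ha : 0 ≤ a) :
    Tendsto (fun h : ℝ => h⁻¹ * ∫ τ in a..a + h, N τ) (𝓝[>] 0) (𝓝 (N a)) := by
  have hd : HasDerivWithinAt (fun u => ∫ τ in a..u, N τ) (N a) (Ici a) a := by
    refine intervalIntegral.integral_hasDerivWithinAt_right (by simp) (t := Ioi a) ?_ ?_
    · exact ⟨Ioi a, self_mem_nhdsWithin,
        (hN.mono (fun x hx => ha.trans (le_of_lt hx))).aestronglyMeasurable measurableSet_Ioi⟩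
    · exact (hN a ha).mono (fun x hx => ha.trans (le_of_lt hx))
  have h1 := (hasDerivWithinAt_iff_tendsto_slope' (by simp)).1 hd.Ioi_of_Ici
  have h2 : Tendsto (fun h : ℝ => a + h) (𝓝[>] 0) (𝓝[>] a) := by
    refine tendsto_nhdsWithin_iff.2 ⟨?_, ?_⟩
    · exact (((continuous_const.add continuous_id).tendsto' 0 a (by simp))).mono_left nhdsWithin_le_nhds
    · filter_upwards [self_mem_nhdsWithin] with h hh
      simpa using hh
  refine (h1.comp h2).congr fun h => ?_
  simp [slope]

/-- The parameter h is both the length of the interval and an argument of the integrand, hence the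
need for joint continuity. -/
theorem tendsto_average_of_continuous {J : ℝ × ℝ → ℝ} (hJ : Continuous J) :
    Tendsto (fun h : ℝ => h⁻¹ * ∫ θ in (0 : ℝ)..h, J (θ, h)) (𝓝[>] 0) (𝓝 (J (0, 0))) := by
  rw [Metric.tendsto_nhds]
  intro ε hε
  obtain ⟨δ, hδ, hball⟩ := Metric.continuousAt_iff.1 (hJ.continuousAt (x := (0, 0))) (ε / 2) (by linarith)
  filter_upwards [Ioo_mem_nhdsGT hδ] with h hh
  have hc : h⁻¹ * (∫ θ in (0 : ℝ)..h, J (0, 0)) = J (0, 0) := by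
    rw [intervalIntegral.integral_const, sub_zero, smul_eq_mul, inv_mul_cancel_left₀ hh.1.ne']
  have ci : IntervalIntegrable (fun θ => J (θ, h)) volume 0 h :=
    (hJ.comp (continuous_id.prodMk continuous_const)).intervalIntegrable _ _
  rw [← hc, Real.dist_eq, ← mul_sub, ← intervalIntegral.integral_sub ci (by simp), abs_mul,
    abs_of_pos (inv_pos.2 hh.1)]
  have := intervalIntegral.norm_integral_le_of_norm_le_const (a := 0) (b := h) (C := ε / 2)
    (f := fun θ => J (θ, h) - J (0, 0)) (fun θ hθ => ?_)
  · rw [Real.norm_eq_abs, sub_zero, abs_of_pos hh.1] at this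
    calc h⁻¹ * |∫ θ in (0 : ℝ)..h, (J (θ, h) - J (0, 0))| ≤ h⁻¹ * (ε / 2 * h) := by
          gcongr
          exact (inv_pos.2 hh.1).le
      _ = ε / 2 := by field_simp [hh.1.ne']
      _ < ε := by linarith
  · rw [uIoc_of_le hh.1.le] at hθ
    refine (hball ?_).le
    rw [Prod.dist_eq]
    refine max_lt ?_ ?_ <;> rw [Real.dist_eq, sub_zero, abs_of_pos] <;> linarith [hθ.1, hθ.2, hh.1, hh.2]

/-- If the increments of `N` are `N (t + h) - N t = ∫ F (Y (t + h) + Y t)` over `(t, t + h)`, then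
`N` is a primitive of `2 ⟨F, Y⟩`. -/
theorem sub_eq_two_mul_integral_of_increments {F : ℝ → StrongDual ℝ E} {Y : ℝ → E} {N : ℝ → ℝ}
    (hF : ∀ T : ℝ, 0 < T → MemLp F 2 (volume.restrict (Ioo 0 T)))
    (hY : ∀ T : ℝ, 0 < T → MemLp Y 2 (volume.restrict (Ioo 0 T)))
    (hN : ContinuousOn N (Ici 0))
    (hinc : ∀ h : ℝ, 0 < h → ∀ᵐ τ ∂volume.restrict (Ioi (0 : ℝ)),
      N (τ + h) - N τ = ∫ r in τ..τ + h, F r (Y (τ + h) + Y τ))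
    {a b : ℝ} (ha : 0 ≤ a) (hab : a ≤ b) :
    N b - N a = 2 * ∫ τ in a..b, F τ (Y τ) := by
  have hb : 0 ≤ b := ha.trans hab
  -- Shifts by h < 1 of points of (a, b] stay inside (0, T), where the global extensions agree with
  -- `F` and `Y`.
  obtain ⟨T, hT⟩ : ∃ T : ℝ, T = b + 1 := ⟨_, rfl⟩
  have hT0 : 0 < T := by linarith
  obtain ⟨F', hF', hF'def⟩ := (hF T hT0).exists_extension measurableSet_Ioo
  obtain ⟨Y', hY', hY'def⟩ := (hY T hT0).exists_extension measurableSet_Ioo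
  let J : ℝ × ℝ → ℝ := fun p => ∫ τ in Ioc a b, F' (p.1 + τ) (Y' (p.2 + τ) + Y' τ)
  have hJ : Continuous J := continuous_setIntegral_translate hF' hY' _
  have hJ0 : J (0, 0) = 2 * ∫ τ in a..b, F τ (Y τ) := by
    simp only [J, zero_add]
    rw [intervalIntegral.integral_of_le hab, ← integral_const_mul]
    refine setIntegral_congr_fun measurableSet_Ioc fun τ hτ => ?_
    have : τ ∈ Ioo 0 T := ⟨ha.trans_lt hτ.1, by linarith [hτ.2]⟩
    simp only [hF'def τ this, hY'def τ this, map_add]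
    ring
  have hNi : ∀ c d : ℝ, 0 ≤ c → 0 ≤ d → IntervalIntegrable N volume c d := fun c d hc hd =>
    (hN.mono fun x hx => (le_min hc hd).trans hx.1).intervalIntegrable
  -- Integrating the increments over (a, b) telescopes to integrals of `N` over two intervals of
  -- length h. On the other side, the order of integration is exchanged.
  have hid : ∀ h ∈ Ioo (0 : ℝ) 1, h⁻¹ * (∫ τ in b..b + h, N τ) - h⁻¹ * (∫ τ in a..a + h, N τ)
      = h⁻¹ * ∫ θ in (0 : ℝ)..h, J (θ, h) := by
    intro h hh
    rw [← mul_sub]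
    congr 1
    have e1 : ∫ θ in (0 : ℝ)..h, J (θ, h)
        = ∫ τ in a..b, ∫ θ in (0 : ℝ)..h, F' (θ + τ) (Y' (h + τ) + Y' τ) := by
      have hY2 : MemLp (fun τ => Y' (h + τ) + Y' τ) 2 volume :=
        (hY'.comp_measurePreserving (measurePreserving_add_left volume h)).add hY'
      rw [intervalIntegral_swap_translate hF' hY2]
      simp only [J, intervalIntegral.integral_of_le hab]
    have e2 : ∫ τ in a..b, ∫ θ in (0 : ℝ)..h, F' (θ + τ) (Y' (h + τ) + Y' τ)
        = ∫ τ in a..b, (N (τ + h) - N τ) := by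
      refine intervalIntegral.integral_congr_ae' ?_ (by simp [Ioc_eq_empty (not_lt.2 hab)])
      have := (ae_restrict_iff' measurableSet_Ioi).1 (hinc h hh.1)
      filter_upwards [this] with τ hτ hτm
      have hτ0 : 0 < τ := ha.trans_lt hτm.1
      rw [hτ hτ0]
      have m1 : τ ∈ Ioo 0 T := ⟨hτ0, by linarith [hτm.2]⟩
      have m2 : h + τ ∈ Ioo 0 T := ⟨by linarith [hh.1], by linarith [hτm.2, hh.2]⟩
      simp only [hY'def _ m1, hY'def _ m2]
      rw [intervalIntegral.integral_comp_add_right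
        (fun r => F' r (Y (h + τ) + Y τ)) τ, zero_add, add_comm h τ]
      refine intervalIntegral.integral_congr fun r hr => ?_
      rw [uIcc_of_le (by linarith [hh.1])] at hr
      have m3 : r ∈ Ioo 0 T := ⟨by linarith [hr.1], by linarith [hr.2, hτm.2, hh.2]⟩
      simp only [hF'def _ m3]
    rw [e1, e2, intervalIntegral.integral_sub ?_ (hNi a b ha hb),
      intervalIntegral.integral_comp_add_right (fun r => N r) h,
      intervalIntegral.integral_interval_sub_interval_comm'
        (hNi _ _ (by linarith [hh.1]) (by linarith [hh.1])) (hNi _ _ ha hb)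
        (hNi _ _ (by linarith [hh.1]) ha)]
    refine (hN.comp (continuous_id.add continuous_const).continuousOn fun x hx => ?_).intervalIntegrable
    rw [uIcc_of_le hab] at hx
    exact add_nonneg (ha.trans hx.1) hh.1.le
  have l1 := (tendsto_average_right hN hb).sub (tendsto_average_right hN ha)
  have l2 := tendsto_average_of_continuous hJ
  rw [← hJ0]
  refine tendsto_nhds_unique (l1.congr' ?_) l2
  filter_upwards [Ioo_mem_nhdsGT one_pos] with h hh using hid h hh

end Energy

/-! ### Local integrability and the product rule with an exponential weight -/

section LocalIntegrability

variable {G : Type*} [NormedAddCommGroup G]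

theorem intervalIntegrable_of_integrable_Ioo {g : ℝ → G}
    (hg : ∀ T : ℝ, 0 < T → Integrable g (volume.restrict (Ioo 0 T)))
    {a b : ℝ} (ha : 0 ≤ a) (hb : 0 ≤ b) : IntervalIntegrable g volume a b := by
  have hT : 0 < max a b + 1 := by positivity
  rw [intervalIntegrable_iff]
  refine IntegrableOn.mono_set (t := Ioo 0 (max a b + 1)) (hg _ hT) fun x hx => ?_
  rw [uIoc, mem_Ioc] at hx
  exact ⟨(le_min ha hb).trans_lt hx.1, by linarith [hx.2]⟩

theorem intervalIntegrable_of_memLp_Ioo {g : ℝ → G}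
    (hg : ∀ T : ℝ, 0 < T → MemLp g 2 (volume.restrict (Ioo 0 T)))
    {a b : ℝ} (ha : 0 ≤ a) (hb : 0 ≤ b) : IntervalIntegrable g volume a b :=
  intervalIntegrable_of_integrable_Ioo (fun T hT => (hg T hT).integrable (by norm_num)) ha hb

theorem continuousOn_primitive_Ici [NormedSpace ℝ G] {g : ℝ → G}
    (hg : ∀ T : ℝ, 0 ≤ T → IntervalIntegrable g volume 0 T) :
    ContinuousOn (fun t => ∫ τ in (0 : ℝ)..t, g τ) (Ici 0) := by
  intro x hx
  have hx0 : (0 : ℝ) ≤ x := hx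
  have := intervalIntegral.continuousOn_primitive_interval' (hg (x + 1) (by linarith))
    left_mem_uIcc
  rw [uIcc_of_le (by linarith)] at this
  refine (this x ⟨hx0, by linarith⟩).mono_of_mem_nhdsWithin ?_
  rw [← Ici_inter_Iic]
  exact inter_mem self_mem_nhdsWithin (mem_nhdsWithin_of_mem_nhds (Iic_mem_nhds (by linarith)))

theorem memLp_Ioo_of_continuousOn {g : ℝ → G} (hg : ContinuousOn g (Ici 0)) (p : ℝ≥0∞) (T : ℝ) :
    MemLp g p (volume.restrict (Ioo 0 T)) := by
  have hsub : Icc 0 T ⊆ Ici (0 : ℝ) := fun x hx => hx.1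
  obtain ⟨C, hC⟩ := isCompact_Icc.exists_bound_of_continuousOn (hg.mono hsub)
  refine MemLp.of_bound ((hg.mono (Ioo_subset_Icc_self.trans hsub)).aestronglyMeasurable
    measurableSet_Ioo) C ?_
  filter_upwards [ae_restrict_mem measurableSet_Ioo] with x hx using hC x (Ioo_subset_Icc_self hx)

theorem integrable_dual_apply {E X : Type*} [NormedAddCommGroup E] [NormedSpace ℝ E]
    [MeasurableSpace X] {μ : Measure X} {F : X → StrongDual ℝ E} {Y : X → E}
    (hF : MemLp F 2 μ) (hY : MemLp Y 2 μ) : Integrable (fun x => F x (Y x)) μ :=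
  memLp_one_iff_integrable.1
    ((ContinuousLinearMap.id ℝ (StrongDual ℝ E)).memLp_of_bilin 1 hF hY)

/-- Here `q` is only a primitive of an integrable function, so this is integration by parts for
absolutely continuous functions, applied to `q - q a`. The constant `q a` is treated separately. -/
theorem exp_mul_sub_eq_integral {q g : ℝ → ℝ} {a b : ℝ} (c : ℝ) (hab : a ≤ b)
    (hg : IntervalIntegrable g volume a b)
    (hq : ∀ t ∈ Icc a b, q t = q a + ∫ τ in a..t, g τ) :
    Real.exp (c * b) * q b - Real.exp (c * a) * q a
      = ∫ τ in a..b, Real.exp (c * τ) * (c * q τ + g τ) := by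
  have hφ : AbsolutelyContinuousOnInterval (fun t => Real.exp (c * t)) a b :=
    ContDiffOn.absolutelyContinuousOnInterval
      (Real.contDiff_exp.comp (contDiff_const.mul contDiff_id)).contDiffOn
  have hP := hg.absolutelyContinuousOnInterval_intervalIntegral (c := a) left_mem_uIcc
  have hI := hφ.integral_deriv_mul_eq_sub hP
  have hd : ∀ x, deriv (fun t => Real.exp (c * t)) x = Real.exp (c * x) * c := fun x => by
    simpa using (((hasDerivAt_id x).const_mul c).exp).deriv
  have h1 : ∫ τ in a..b, Real.exp (c * τ) * c = Real.exp (c * b) - Real.exp (c * a) := by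
    refine intervalIntegral.integral_eq_sub_of_hasDerivAt
      (f := fun t => Real.exp (c * t)) (fun x _ => ?_) ?_
    · simpa using ((hasDerivAt_id x).const_mul c).exp
    · exact (by fun_prop : Continuous fun τ => Real.exp (c * τ) * c).intervalIntegrable _ _
  have hgd := hg.ae_hasDerivAt_integral
  have h2 : ∫ τ in a..b, Real.exp (c * τ) * (c * q τ + g τ)
      = ∫ τ in a..b, (q a * (Real.exp (c * τ) * c)
        + (deriv (fun t => Real.exp (c * t)) τ * (∫ r in a..τ, g r)
        + Real.exp (c * τ) * deriv (fun t => ∫ r in a..t, g r) τ)) := by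
    refine intervalIntegral.integral_congr_ae ?_
    filter_upwards [hgd] with x hx hxm
    have hxm' := uIoc_subset_uIcc hxm
    rw [(hx hxm' a left_mem_uIcc).deriv, hd, hq x (by rwa [uIcc_of_le hab] at hxm')]
    ring
  have hi1 : IntervalIntegrable (fun τ => q a * (Real.exp (c * τ) * c)) volume a b :=
    (by fun_prop : Continuous fun τ => q a * (Real.exp (c * τ) * c)).intervalIntegrable _ _
  have hi2 : IntervalIntegrable (fun τ => deriv (fun t => Real.exp (c * t)) τ * (∫ r in a..τ, g r)
        + Real.exp (c * τ) * deriv (fun t => ∫ r in a..t, g r) τ) volume a b :=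
    (hφ.intervalIntegrable_deriv.mul_continuousOn hP.continuousOn).add
      (hP.intervalIntegrable_deriv.continuousOn_mul hφ.continuousOn)
  rw [h2, intervalIntegral.integral_add hi1 hi2, intervalIntegral.integral_const_mul, h1, hI,
    hq b ⟨hab, le_rfl⟩]
  simp
  ring

end LocalIntegrability

/-! ### Energy identity for weak solutions -/

variable {V H : Type*}
  [NormedAddCommGroup V] [InnerProductSpace ℝ V]
  [NormedAddCommGroup H] [InnerProductSpace ℝ H]

/-- The energy identity for weak solutions of `ẏ = f`. -/
theorem IsWeakPrimitive.norm_sq_sub {ι : V →L[ℝ] H} {f : ℝ → StrongDual ℝ V} {y₀ : H}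
    {y : ℝ → H} {yV : ℝ → V} (h : IsWeakPrimitive ι f y₀ y yV) {a b : ℝ} (ha : 0 ≤ a)
    (hab : a ≤ b) : ‖y b‖ ^ 2 - ‖y a‖ ^ 2 = 2 * ∫ τ in a..b, f τ (yV τ) := by
  refine sub_eq_two_mul_integral_of_increments (N := fun t => ‖y t‖ ^ 2) h.memLp_deriv h.memLp
    (h.continuousOn.norm.pow 2) (fun d hd => ?_) ha hab
  have h1 := (ae_restrict_iff' measurableSet_Ioi).1 h.ae_eq
  have h2 := (measurePreserving_add_right (volume : Measure ℝ) d).quasiMeasurePreserving.ae h1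
  rw [ae_restrict_iff' measurableSet_Ioi]
  filter_upwards [h1, h2] with τ e1 e2 hτ
  have hτ0 : 0 < τ := hτ
  have hτd : 0 < τ + d := by linarith
  -- With this test vector, (y(τ + d) - y(τ), ιv) is the difference of the squared norms.
  set v := yV (τ + d) + yV τ with hv
  have hιv : ι v = y (τ + d) + y τ := by rw [hv, map_add, e1 hτ, e2 hτd]
  have hfi : ∀ c d : ℝ, 0 ≤ c → 0 ≤ d → IntervalIntegrable (fun r => f r v) volume c d :=
    fun c d hc hd => intervalIntegrable_of_integrable_Ioo (fun T hT =>
      ((h.memLp_deriv T hT).integrable (by norm_num)).apply_continuousLinearMap v) hc hd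
  have w1 := h.weak v (τ + d) hτd.le
  have w2 := h.weak v τ hτ0.le
  have w3 := intervalIntegral.integral_add_adjacent_intervals (hfi 0 τ le_rfl hτ0.le)
    (hfi τ (τ + d) hτ0.le hτd.le)
  rw [hιv, inner_add_right] at w1 w2
  rw [real_inner_self_eq_norm_sq] at w1 w2
  have := real_inner_comm (y τ) (y (τ + d))
  linarith

/-! ### Memory energies and their sign -/

/-- `∫₀ᵗ ⟨B ∫₀^τ g, g(τ)⟩ dτ = ½ ⟨B ∫₀ᵗ g, ∫₀ᵗ g⟩` for symmetric `B`. -/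
theorem two_mul_integral_apply_primitive [CompleteSpace V] {B : V →L[ℝ] StrongDual ℝ V}
    (hB : ∀ v w, B v w = B w v) {g : ℝ → V}
    (hg : ∀ T : ℝ, 0 < T → MemLp g 2 (volume.restrict (Ioo 0 T))) {t : ℝ} (ht : 0 ≤ t) :
    2 * ∫ τ in (0 : ℝ)..t, B (∫ s in (0 : ℝ)..τ, g s) (g τ)
      = B (∫ s in (0 : ℝ)..t, g s) (∫ s in (0 : ℝ)..t, g s) := by
  have hi : ∀ c d : ℝ, 0 ≤ c → 0 ≤ d → IntervalIntegrable g volume c d :=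
    fun c d hc hd => intervalIntegrable_of_memLp_Ioo hg hc hd
  have hc := continuousOn_primitive_Ici fun T hT => hi 0 T le_rfl hT
  -- For the primitive G of g, symmetry makes the increment of B(G, G) equal to B applied to the
  -- increment of G, paired with the sum of the end values.
  have key := sub_eq_two_mul_integral_of_increments
    (F := fun τ => B (g τ)) (Y := fun τ => ∫ s in (0 : ℝ)..τ, g s)
    (N := fun τ => B (∫ s in (0 : ℝ)..τ, g s) (∫ s in (0 : ℝ)..τ, g s))
    (fun T hT => B.comp_memLp' (hg T hT)) (fun T _ => memLp_Ioo_of_continuousOn hc 2 T)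
    ((B.continuous.comp_continuousOn hc).clm_apply hc) (fun d hd => ?_) le_rfl ht
  · simp only [intervalIntegral.integral_same, map_zero, sub_zero] at key
    rw [key]
    simp only [hB (g _)]
  · filter_upwards [ae_restrict_mem measurableSet_Ioi] with τ hτ
    have hτ0 : 0 < τ := hτ
    have hτd : 0 < τ + d := by linarith
    have hsum := intervalIntegral.integral_add_adjacent_intervals (hi 0 τ le_rfl hτ0.le)
      (hi τ (τ + d) hτ0.le hτd.le)
    have hcomm := (B.flip ((∫ s in (0 : ℝ)..τ + d, g s) + ∫ s in (0 : ℝ)..τ, g s)).intervalIntegral_comp_comm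
      (hi τ (τ + d) hτ0.le hτd.le)
    simp only [ContinuousLinearMap.flip_apply] at hcomm
    rw [hcomm, ← hsum]
    simp only [map_add, add_apply]
    rw [hB (∫ s in τ..τ + d, g s) (∫ s in (0 : ℝ)..τ, g s)]
    ring

theorem memLp_exp_smul {g : ℝ → V} (γ : ℝ) {T : ℝ} (hg : MemLp g 2 (volume.restrict (Ioo 0 T))) :
    MemLp (fun s => Real.exp (γ * s) • g s) 2 (volume.restrict (Ioo 0 T)) := by
  refine hg.of_le_mul (c := Real.exp (|γ| * T))
    ((by fun_prop : Continuous fun s => Real.exp (γ * s)).aestronglyMeasurable.smul hg.1) ?_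
  filter_upwards [ae_restrict_mem measurableSet_Ioo] with s hs
  rw [norm_smul, Real.norm_eq_abs, Real.abs_exp]
  refine mul_le_mul_of_nonneg_right (Real.exp_le_exp.2 ?_) (norm_nonneg _)
  calc γ * s ≤ |γ| * s := mul_le_mul_of_nonneg_right (le_abs_self γ) hs.1.le
    _ ≤ |γ| * T := mul_le_mul_of_nonneg_left hs.2.le (abs_nonneg γ)

theorem weightedPower_eq [CompleteSpace V] (γ : ℝ) (B : V →L[ℝ] StrongDual ℝ V) {g : ℝ → V}
    (hg : ∀ T : ℝ, 0 < T → MemLp g 2 (volume.restrict (Ioo 0 T))) {τ : ℝ} (hτ : 0 ≤ τ) :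
    weightedPower γ B g τ
      = B (∫ s in (0 : ℝ)..τ, Real.exp (γ * s) • g s) (Real.exp (γ * τ) • g τ) := by
  rw [weightedPower, B.intervalIntegral_comp_comm (intervalIntegrable_of_memLp_Ioo
    (fun T hT => memLp_exp_smul γ (hg T hT)) le_rfl hτ)]

theorem intervalIntegrable_weightedPower [CompleteSpace V] (γ : ℝ) (B : V →L[ℝ] StrongDual ℝ V)
    {g : ℝ → V} (hg : ∀ T : ℝ, 0 < T → MemLp g 2 (volume.restrict (Ioo 0 T)))
    {a b : ℝ} (ha : 0 ≤ a) (hb : 0 ≤ b) :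
    IntervalIntegrable (weightedPower γ B g) volume a b := by
  have hc := continuousOn_primitive_Ici fun T hT => intervalIntegrable_of_memLp_Ioo
    (fun T hT => memLp_exp_smul γ (hg T hT)) le_rfl hT
  refine intervalIntegrable_of_integrable_Ioo (fun T hT => ?_) ha hb
  refine (integrable_dual_apply (B.comp_memLp' (memLp_Ioo_of_continuousOn hc 2 T))
    (memLp_exp_smul γ (hg T hT))).congr ?_
  filter_upwards [ae_restrict_mem measurableSet_Ioo] with τ hτ
  exact (weightedPower_eq γ B hg hτ.1.le).symm

theorem weightedEnergy_nonneg [CompleteSpace V] {η : ℝ} (hη : 0 ≤ η) (γ : ℝ)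
    {B : V →L[ℝ] StrongDual ℝ V} (hB : ∀ v w, B v w = B w v) (hB0 : ∀ v, 0 ≤ B v v)
    {g : ℝ → V} (hg : ∀ T : ℝ, 0 < T → MemLp g 2 (volume.restrict (Ioo 0 T)))
    {t : ℝ} (ht : 0 ≤ t) : 0 ≤ weightedEnergy η γ B g t := by
  have h1 := two_mul_integral_apply_primitive hB (fun T hT => memLp_exp_smul γ (hg T hT)) ht
  have h2 : ∫ τ in (0 : ℝ)..t, weightedPower γ B g τ
      = ∫ τ in (0 : ℝ)..t, B (∫ s in (0 : ℝ)..τ, Real.exp (γ * s) • g s)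
        (Real.exp (γ * τ) • g τ) := by
    refine intervalIntegral.integral_congr fun τ hτ => ?_
    rw [uIcc_of_le ht] at hτ
    exact weightedPower_eq γ B hg hτ.1
  rw [weightedEnergy, mul_comm 2 η, mul_assoc, h2, h1]
  exact mul_nonneg hη (hB0 _)

/-- The kernel factorizes: e^{2γτ} e^{-γ(τ - s)} = e^{γτ} e^{γs}. This is why the kernel's rate γ is
also the decay rate obtained for the norm. -/
theorem IsExponentialMemory.weightedPower_eq {γ : ℝ} {B : V →L[ℝ] StrongDual ℝ V}
    {Am : HistoryOperator V} (h : IsExponentialMemory γ B Am) {g : ℝ → V} {τ : ℝ} (hτ : 0 < τ)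
    (hg : MemLp g 2 (volume.restrict (Ioo 0 τ))) :
    weightedPower γ B g τ = Real.exp (2 * γ * τ) * Am.toFun g τ (g τ) := by
  rw [h τ hτ g hg, weightedPower]
  have : ∀ s, Real.exp (-γ * (τ - s)) • B (g s)
      = Real.exp (-γ * τ) • B (Real.exp (γ * s) • g s) := fun s => by
    rw [map_smul, smul_smul, ← Real.exp_add]
    congr 2
    ring
  simp only [this]
  rw [intervalIntegral.integral_smul, smul_apply, map_smul, smul_eq_mul,
    smul_eq_mul, ← mul_assoc, ← Real.exp_add]
  congr 2
  ring

theorem memoryEnergy_nonneg {η : ℝ} (hη : 0 ≤ η) {Am : HistoryOperator V}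
    (hAm : IsPositiveMemory Am) {g : ℝ → V}
    (hg : ∀ T : ℝ, 0 < T → MemLp g 2 (volume.restrict (Ioo 0 T))) {t : ℝ} (ht : 0 ≤ t) :
    0 ≤ memoryEnergy η Am g t := by
  rcases ht.eq_or_lt with rfl | ht
  · simp [memoryEnergy]
  · exact mul_nonneg (by positivity) (hAm t ht g (hg t ht))

/-! ### Reaction-convection term and integrability of the memory power -/

/-- Weak measurability of `F` suffices for the measurability of `t ↦ ⟨F(t) u(t), u(t)⟩`. -/
theorem aestronglyMeasurable_apply_apply {X : Type*} [MeasurableSpace X] {μ : Measure X}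
    {F : X → V →L[ℝ] StrongDual ℝ V} (hF : ∀ v w, AEStronglyMeasurable (fun t => F t v w) μ)
    {u : X → V} (hu : AEStronglyMeasurable u μ) :
    AEStronglyMeasurable (fun t => F t (u t) (u t)) μ := by
  obtain ⟨u', hu', huu'⟩ := hu
  suffices h : AEStronglyMeasurable (fun t => F t (u' t) (u' t)) μ by
    refine h.congr ?_
    filter_upwards [huu'] with t ht
    rw [ht]
  refine aestronglyMeasurable_of_tendsto_ae atTop
    (f := fun n t => F t (hu'.approx n t) (hu'.approx n t)) (fun n => ?_)
    (Eventually.of_forall fun t => ?_)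
  -- A simple function has finitely many values, so weak measurability is applied on each fibre.
  -- Continuity of each `F t` then allows the passage to the limit.
  · have hfin : (fun t => F t (hu'.approx n t) (hu'.approx n t))
        = fun t => ∑ v ∈ (hu'.approx n).range, (hu'.approx n ⁻¹' {v}).indicator (fun t => F t v v) t := by
      funext t
      rw [Finset.sum_eq_single (hu'.approx n t)]
      · simp
      · intro v _ hv
        exact indicator_of_notMem (fun h => hv h.symm) _
      · intro h
        exact absurd ((hu'.approx n).mem_range_self t) h
    rw [hfin]
    refine Finset.aestronglyMeasurable_fun_sum _ fun v _ => ?_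
    exact (hF v v).indicator ((hu'.approx n).measurableSet_fiber v)
  · have hc : Continuous fun v => F t v v := (F t).continuous.clm_apply continuous_id
    exact (hc.tendsto _).comp (hu'.tendsto_approx t)

/-- Both summands of the decomposition yield the mixed product ‖ιv‖‖v‖. A bound by ‖v‖² alone could
not be absorbed by enlarging ϱ. -/
theorem IsBoundedReactionConvection.exists_bound {ι : V →L[ℝ] H}
    {Arc : ℝ → V →L[ℝ] StrongDual ℝ V} (h : IsBoundedReactionConvection ι Arc) :
    ∃ C : ℝ, ∀ᵐ t ∂volume.restrict (Ioi (0 : ℝ)), ∀ v, |Arc t v v| ≤ C * ‖ι v‖ * ‖v‖ := by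
  obtain ⟨C, hC⟩ := h.bounded
  refine ⟨C, ?_⟩
  filter_upwards [hC] with t ht v
  obtain ⟨B₁, B₂, hB, hn⟩ := ht
  have h1 : |B₁ (ι v) v| ≤ ‖B₁‖ * ‖ι v‖ * ‖v‖ := B₁.le_opNorm₂ (ι v) v
  have h2 : |inner ℝ (B₂ v) (ι v)| ≤ ‖B₂‖ * ‖ι v‖ * ‖v‖ := by
    refine (abs_real_inner_le_norm _ _).trans ?_
    nlinarith [mul_le_mul_of_nonneg_right (B₂.le_opNorm v) (norm_nonneg (ι v))]
  have h3 : Arc t v v = B₁ (ι v) v + inner ℝ (B₂ v) (ι v) := by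
    rw [hB v]
    rfl
  rw [h3]
  refine (abs_add_le _ _).trans ((add_le_add h1 h2).trans ?_)
  rw [← add_mul, ← add_mul]
  gcongr

theorem integrable_reactionConvection {ι : V →L[ℝ] H} {Arc : ℝ → V →L[ℝ] StrongDual ℝ V}
    (hArc : IsBoundedReactionConvection ι Arc) {g : ℝ → V} {T : ℝ}
    (hg : MemLp g 2 (volume.restrict (Ioo 0 T))) :
    Integrable (fun t => Arc t (g t) (g t)) (volume.restrict (Ioo 0 T)) := by
  have hle : volume.restrict (Ioo 0 T) ≤ volume.restrict (Ioi (0 : ℝ)) :=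
    Measure.restrict_mono Ioo_subset_Ioi_self le_rfl
  obtain ⟨C, hC⟩ := hArc.exists_bound
  refine Integrable.mono' ((hg.integrable_norm_pow (by simp)).const_mul (|C| * ‖ι‖))
    (aestronglyMeasurable_apply_apply (fun v w => (hArc.measurable v w).mono_measure hle) hg.1) ?_
  filter_upwards [ae_mono hle hC] with t ht
  have h1 : C * ‖ι (g t)‖ ≤ |C| * (‖ι‖ * ‖g t‖) :=
    mul_le_mul (le_abs_self C) (ι.le_opNorm _) (norm_nonneg _) (abs_nonneg _)
  calc ‖Arc t (g t) (g t)‖ ≤ C * ‖ι (g t)‖ * ‖g t‖ := ht (g t)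
    _ ≤ |C| * (‖ι‖ * ‖g t‖) * ‖g t‖ := by gcongr
    _ = |C| * ‖ι‖ * ‖g t‖ ^ (2 : ℕ) := by ring

/-- No bound on the memory operator is assumed. The equation expresses its power through the
remaining terms, which are all integrable. -/
theorem IsWeakPrimitive.integrable_memoryPower {ι : V →L[ℝ] H} {A : V →L[ℝ] StrongDual ℝ V}
    {Arc : ℝ → V →L[ℝ] StrongDual ℝ V} (hArc : IsBoundedReactionConvection ι Arc) {η : ℝ}
    {Am : HistoryOperator V} {r : ℝ → StrongDual ℝ V} (hr : ContinuousOn r (Ici 0)) {y₀ : H}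
    {y : ℝ → H} {yV : ℝ → V}
    (h : IsWeakPrimitive ι (fun t => -A (yV t) - Arc t (yV t) - η • Am.toFun yV t + r t) y₀ y yV)
    {T : ℝ} (hT : 0 < T) :
    Integrable (fun t => η * Am.toFun yV t (yV t)) (volume.restrict (Ioo 0 T)) := by
  have hy := h.memLp T hT
  refine ((((integrable_dual_apply (memLp_Ioo_of_continuousOn hr 2 T) hy).sub
    (integrable_dual_apply (h.memLp_deriv T hT) hy)).sub
    (integrable_dual_apply (A.comp_memLp' hy) hy)).sub
    (integrable_reactionConvection hArc hy)).congr (Eventually.of_forall fun t => ?_)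
  simp
  ring

theorem IsWeakSolution.intervalIntegrable_memoryPower {ι : V →L[ℝ] H} {A : V →L[ℝ] StrongDual ℝ V}
    {Arc : ℝ → V →L[ℝ] StrongDual ℝ V} {η : ℝ}
    {Am : HistoryOperator V} {m n : ℕ} {U : EuclideanSpace ℝ (Fin m) →L[ℝ] H}
    {K : H →L[ℝ] EuclideanSpace ℝ (Fin m)} {W : H →L[ℝ] EuclideanSpace ℝ (Fin n)}
    {L : EuclideanSpace ℝ (Fin n) →L[ℝ] StrongDual ℝ V} {z₀ y₀ : H} {z y : ℝ → H} {zV yV : ℝ → V}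
    (h : IsWeakSolution ι A Arc η Am U K W L z₀ y₀ z y zV yV)
    (hArc : IsBoundedReactionConvection ι Arc) {a b : ℝ} (ha : 0 ≤ a) (hb : 0 ≤ b) :
    IntervalIntegrable (fun τ => η * Am.toFun zV τ (zV τ)) volume a b ∧
    IntervalIntegrable (fun τ => η * Am.toFun yV τ (yV τ)) volume a b := by
  obtain ⟨hz, hy⟩ := h
  have hpiv : Continuous (pivot ι) :=
    ((ContinuousLinearMap.compL ℝ V H ℝ).flip ι).continuous.comp (innerSL ℝ).continuous
  refine ⟨intervalIntegrable_of_integrable_Ioo (fun T hT => hz.integrable_memoryPower hArc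
    ((L.comp W).continuous.comp_continuousOn hz.continuousOn) hT) ha hb,
    intervalIntegrable_of_integrable_Ioo (fun T hT =>
      IsWeakPrimitive.integrable_memoryPower (A := A)
      (r := fun t => pivot ι (U (K (y t))) + pivot ι (U (K (z t)))) hArc
      (((hpiv.comp (U.comp K).continuous).comp_continuousOn hy.continuousOn).add
      ((hpiv.comp (U.comp K).continuous).comp_continuousOn hz.continuousOn))
      (by simpa only [add_assoc] using hy) hT) ha hb⟩

/-! ### Weighted dissipation -/

/-- Integrated form of q' + cq + m ≤ 0 multiplied by e^{cτ}, for absolutely continuous q. -/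
theorem exp_mul_add_integral_le {q g m : ℝ → ℝ} {s t : ℝ} (c : ℝ) (hs : 0 ≤ s) (hst : s ≤ t)
    (hqc : ContinuousOn q (Icc s t)) (hg : IntervalIntegrable g volume s t)
    (hq : ∀ r ∈ Icc s t, q r = q s + ∫ τ in s..r, g τ) (hm : IntervalIntegrable m volume s t)
    (hneg : ∀ᵐ τ ∂volume.restrict (Ioi (0 : ℝ)), c * q τ + g τ + m τ ≤ 0) :
    Real.exp (c * t) * q t + ∫ τ in s..t, Real.exp (c * τ) * m τ ≤ Real.exp (c * s) * q s := by
  have hec : ContinuousOn (fun τ => Real.exp (c * τ)) (uIcc s t) :=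
    (by fun_prop : Continuous fun τ => Real.exp (c * τ)).continuousOn
  rw [← uIcc_of_le hst] at hqc
  have h1 : IntervalIntegrable (fun τ => Real.exp (c * τ) * (c * q τ + g τ)) volume s t :=
    ((hqc.intervalIntegrable.const_mul c).add hg).continuousOn_mul hec
  have h2 := intervalIntegral.integral_add h1 (hm.continuousOn_mul hec)
  have h3 : ∫ τ in s..t, (Real.exp (c * τ) * (c * q τ + g τ) + Real.exp (c * τ) * m τ) ≤ 0 := by
    rw [intervalIntegral.integral_of_le hst]
    refine integral_nonpos_of_ae (ae_restrict_of_ae_restrict_of_subset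
      (fun x hx => hs.trans_lt hx.1) ?_)
    filter_upwards [hneg] with τ hτ
    rw [← mul_add]
    exact mul_nonpos_of_nonneg_of_nonpos (Real.exp_pos _).le hτ
  have h4 := exp_mul_sub_eq_integral c hst hg hq
  linarith

/-- Dissipation of the functional `(1 + κ²) ‖z‖² + ‖y‖²` with the weight `e^{2γt}`. -/
theorem IsWeakSolution.weighted_dissipation {ι : V →L[ℝ] H} {A : V →L[ℝ] StrongDual ℝ V}
    {Arc : ℝ → V →L[ℝ] StrongDual ℝ V} (hArc : IsBoundedReactionConvection ι Arc) {η : ℝ}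
    {Am : HistoryOperator V} {m n : ℕ} {U : EuclideanSpace ℝ (Fin m) →L[ℝ] H}
    {K : H →L[ℝ] EuclideanSpace ℝ (Fin m)} {W : H →L[ℝ] EuclideanSpace ℝ (Fin n)}
    {L : EuclideanSpace ℝ (Fin n) →L[ℝ] StrongDual ℝ V} {z₀ y₀ : H} {z y : ℝ → H} {zV yV : ℝ → V}
    (h : IsWeakSolution ι A Arc η Am U K W L z₀ y₀ z y zV yV) {C γ ϱ : ℝ}
    (hC : ∀ᵐ t ∂volume.restrict (Ioi (0 : ℝ)), ∀ v, |Arc t v v| ≤ C * ‖ι v‖ * ‖v‖)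
    (hϱ : C ^ 2 + 1 + 2 * γ ≤ ϱ)
    (hK : ∀ w, ‖w‖ ^ 2 + ϱ * ‖ι w‖ ^ 2 ≤ 2 * (A w - pivot ι (U (K (ι w)))) w)
    (hL : ∀ w, ‖w‖ ^ 2 + ϱ * ‖ι w‖ ^ 2 ≤ 2 * (A w - L (W (ι w))) w)
    {s t : ℝ} (hs : 0 ≤ s) (hst : s ≤ t) :
    Real.exp (2 * γ * t) * ((1 + ‖U.comp K‖ ^ 2) * ‖z t‖ ^ 2 + ‖y t‖ ^ 2)
      + 2 * ((1 + ‖U.comp K‖ ^ 2) *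
        (∫ τ in s..t, Real.exp (2 * γ * τ) * (η * Am.toFun zV τ (zV τ)))
        + ∫ τ in s..t, Real.exp (2 * γ * τ) * (η * Am.toFun yV τ (yV τ)))
      ≤ Real.exp (2 * γ * s) * ((1 + ‖U.comp K‖ ^ 2) * ‖z s‖ ^ 2 + ‖y s‖ ^ 2) := by
  have ht : 0 ≤ t := hs.trans hst
  obtain ⟨hzm, hym⟩ := h.intervalIntegrable_memoryPower hArc hs ht
  obtain ⟨hz, hy⟩ := h
  set κ := ‖U.comp K‖ with hκ
  set f := fun t => -A (zV t) - Arc t (zV t) - η • Am.toFun zV t + L (W (z t)) with hf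
  set p := fun t => -A (yV t) - Arc t (yV t) - η • Am.toFun yV t
      + pivot ι (U (K (y t))) + pivot ι (U (K (z t))) with hp
  have hfi : ∀ a b : ℝ, 0 ≤ a → 0 ≤ b → IntervalIntegrable (fun τ => f τ (zV τ)) volume a b :=
    fun a b ha hb => intervalIntegrable_of_integrable_Ioo
      (fun T hT => integrable_dual_apply (hz.memLp_deriv T hT) (hz.memLp T hT)) ha hb
  have hpi : ∀ a b : ℝ, 0 ≤ a → 0 ≤ b → IntervalIntegrable (fun τ => p τ (yV τ)) volume a b :=
    fun a b ha hb => intervalIntegrable_of_integrable_Ioo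
      (fun T hT => integrable_dual_apply (hy.memLp_deriv T hT) (hy.memLp T hT)) ha hb
  set g := fun τ => (1 + κ ^ 2) * (2 * f τ (zV τ)) + 2 * p τ (yV τ) with hg
  set q := fun τ => (1 + κ ^ 2) * ‖z τ‖ ^ 2 + ‖y τ‖ ^ 2 with hq
  have hgi : IntervalIntegrable g volume s t :=
    (((hfi s t hs ht).const_mul 2).const_mul _).add ((hpi s t hs ht).const_mul 2)
  have hqc : ContinuousOn q (Ici 0) :=
    (continuousOn_const.mul (hz.continuousOn.norm.pow 2)).add (hy.continuousOn.norm.pow 2)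
  have hqg : ∀ r ∈ Icc s t, q r = q s + ∫ τ in s..r, g τ := by
    intro r hr
    have hr0 := hs.trans hr.1
    have e1 := hz.norm_sq_sub hs hr.1
    have e2 := hy.norm_sq_sub hs hr.1
    rw [hg, intervalIntegral.integral_add (((hfi s r hs hr0).const_mul 2).const_mul _)
      ((hpi s r hs hr0).const_mul 2)]
    simp only [intervalIntegral.integral_const_mul]
    rw [← e1, ← e2]
    simp only [hq]
    ring
  have hneg : ∀ᵐ τ ∂volume.restrict (Ioi (0 : ℝ)), 2 * γ * q τ + g τ
        + 2 * ((1 + κ ^ 2) * (η * Am.toFun zV τ (zV τ)) + η * Am.toFun yV τ (yV τ)) ≤ 0 := by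
    filter_upwards [hC, hz.ae_eq, hy.ae_eq] with τ hCτ ez ey
    have l1 := hL (zV τ)
    have l2 := hK (yV τ)
    have c1 := (abs_le.1 (hCτ (zV τ))).1
    have c2 := (abs_le.1 (hCτ (yV τ))).1
    have hcross : inner ℝ (U (K (z τ))) (y τ) ≤ κ * ‖z τ‖ * ‖y τ‖ :=
      (real_inner_le_norm _ _).trans
        (mul_le_mul_of_nonneg_right ((U.comp K).le_opNorm _) (norm_nonneg _))
    have f1 : f τ (zV τ) + η * Am.toFun zV τ (zV τ)
        = -((A (zV τ) - L (W (ι (zV τ)))) (zV τ)) - Arc τ (zV τ) (zV τ) := by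
      simp [hf, ez]
      ring
    have f2 : p τ (yV τ) + η * Am.toFun yV τ (yV τ)
        = -((A (yV τ) - pivot ι (U (K (ι (yV τ))))) (yV τ)) - Arc τ (yV τ) (yV τ)
          + inner ℝ (U (K (z τ))) (y τ) := by
      have : pivot ι (U (K (z τ))) (yV τ) = inner ℝ (U (K (z τ))) (y τ) := by
        rw [← ey]
        rfl
      rw [← this]
      simp [hp, ey]
      ring
    rw [ez] at l1 c1
    rw [ey] at l2 c2
    rw [ez] at f1
    rw [ey] at f2
    -- Young's inequality 2C‖z‖‖zV‖ ≤ C²‖z‖² + ‖zV‖² uses up the V-norm from coercivity, and ϱ - C²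
    -- ≥ 1 + 2γ remains.
    have b1 : 2 * (f τ (zV τ) + η * Am.toFun zV τ (zV τ)) ≤ -(1 + 2 * γ) * ‖z τ‖ ^ 2 := by
      nlinarith [sq_nonneg (‖zV τ‖ - C * ‖z τ‖),
        mul_le_mul_of_nonneg_right hϱ (sq_nonneg ‖z τ‖)]
    have b2 : 2 * (p τ (yV τ) + η * Am.toFun yV τ (yV τ))
        ≤ -(1 + 2 * γ) * ‖y τ‖ ^ 2 + 2 * (κ * ‖z τ‖ * ‖y τ‖) := by
      nlinarith [sq_nonneg (‖yV τ‖ - C * ‖y τ‖),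
        mul_le_mul_of_nonneg_right hϱ (sq_nonneg ‖y τ‖)]
    have := mul_le_mul_of_nonneg_left b1 (by positivity : 0 ≤ 1 + κ ^ 2)
    simp only [hq, hg]
    -- The terms with 2γ cancel. What is left is at most -(1 + κ²)‖z‖² - ‖y‖² + 2κ‖z‖‖y‖ ≤ -‖z‖².
    nlinarith [sq_nonneg (κ * ‖z τ‖ - ‖y τ‖), sq_nonneg ‖z τ‖]
  have hdiss := exp_mul_add_integral_le (2 * γ) hs hst
    (hqc.mono fun x hx => hs.trans hx.1) hgi hqg (((hzm.const_mul _).add hym).const_mul 2) hneg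
  have hec : ContinuousOn (fun τ => Real.exp (2 * γ * τ)) (uIcc s t) :=
    (by fun_prop : Continuous fun τ => Real.exp (2 * γ * τ)).continuousOn
  have hsum : ∫ τ in s..t, Real.exp (2 * γ * τ) *
        (2 * ((1 + κ ^ 2) * (η * Am.toFun zV τ (zV τ)) + η * Am.toFun yV τ (yV τ)))
      = 2 * ((1 + κ ^ 2) *
        (∫ τ in s..t, Real.exp (2 * γ * τ) * (η * Am.toFun zV τ (zV τ)))
        + ∫ τ in s..t, Real.exp (2 * γ * τ) * (η * Am.toFun yV τ (yV τ))) := by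
    rw [← intervalIntegral.integral_const_mul, ← intervalIntegral.integral_add
      ((hzm.continuousOn_mul hec).const_mul _) (hym.continuousOn_mul hec),
      ← intervalIntegral.integral_const_mul]
    refine intervalIntegral.integral_congr fun τ _ => ?_
    ring
  rw [← hsum]
  exact hdiss

theorem IsEventuallyCoercive.exists_thresholds {ι : V →L[ℝ] H} {A : V →L[ℝ] StrongDual ℝ V}
    {P : ℕ+ → ℝ≥0 → V → StrongDual ℝ V} (h : IsEventuallyCoercive ι A P) {ϱ : ℝ} (hϱ : 0 < ϱ) :
    ∃ (Ns : ℕ+) (ls : ℕ+ → ℝ≥0), ∀ N ≥ Ns, ∀ l ≥ ls N, ∀ w : V,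
      ‖w‖ ^ 2 + ϱ * ‖ι w‖ ^ 2 ≤ 2 * (A w - P N l w) w := by
  obtain ⟨Ns, hN⟩ := h ϱ hϱ
  choose! ls hls using hN
  exact ⟨Ns, ls, hls⟩

/-! ### From dissipation to the two stability estimates -/

section Estimates

variable {ι : V →L[ℝ] H} {A : V →L[ℝ] StrongDual ℝ V} {Arc : ℝ → V →L[ℝ] StrongDual ℝ V}
  {η : ℝ} {Am : HistoryOperator V} {m n : ℕ} {U : EuclideanSpace ℝ (Fin m) →L[ℝ] H}
  {K : H →L[ℝ] EuclideanSpace ℝ (Fin m)} {W : H →L[ℝ] EuclideanSpace ℝ (Fin n)}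
  {L : EuclideanSpace ℝ (Fin n) →L[ℝ] StrongDual ℝ V} {z₀ y₀ : H} {z y : ℝ → H} {zV yV : ℝ → V}

theorem IsWeakSolution.lyapunovEstimate (hη : 0 ≤ η) (hAm : IsPositiveMemory Am)
    (h : IsWeakSolution ι A Arc η Am U K W L z₀ y₀ z y zV yV)
    (hArc : IsBoundedReactionConvection ι Arc) {C ϱ : ℝ}
    (hC : ∀ᵐ t ∂volume.restrict (Ioi (0 : ℝ)), ∀ v, |Arc t v v| ≤ C * ‖ι v‖ * ‖v‖)
    (hϱ : C ^ 2 + 1 ≤ ϱ)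
    (hK : ∀ w, ‖w‖ ^ 2 + ϱ * ‖ι w‖ ^ 2 ≤ 2 * (A w - pivot ι (U (K (ι w)))) w)
    (hL : ∀ w, ‖w‖ ^ 2 + ϱ * ‖ι w‖ ^ 2 ≤ 2 * (A w - L (W (ι w))) w) :
    LyapunovEstimate η Am (‖U.comp K‖ ^ 2) z y zV yV := by
  have hnn := fun (t : ℝ) (ht : 0 ≤ t) =>
    And.intro (memoryEnergy_nonneg hη hAm h.error.memLp ht)
      (memoryEnergy_nonneg hη hAm h.state.memLp ht)
  refine ⟨fun t ht => h.intervalIntegrable_memoryPower hArc le_rfl ht, hnn, fun s t hs hst => ?_⟩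
  have hd := h.weighted_dissipation hArc hC (γ := 0) (by linarith) hK hL hs hst
  have hI : ∀ g : ℝ → V, (∀ r : ℝ, 0 ≤ r →
      IntervalIntegrable (fun τ => η * Am.toFun g τ (g τ)) volume 0 r) →
      2 * ∫ τ in s..t, η * Am.toFun g τ (g τ) = memoryEnergy η Am g t - memoryEnergy η Am g s := by
    intro g hg
    rw [← intervalIntegral.integral_interval_sub_left (hg t (hs.trans hst)) (hg s hs)]
    simp only [memoryEnergy, intervalIntegral.integral_const_mul]
    ring
  have hz := hI zV fun r hr => (h.intervalIntegrable_memoryPower hArc le_rfl hr).1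
  have hy := hI yV fun r hr => (h.intervalIntegrable_memoryPower hArc le_rfl hr).2
  simp only [mul_zero, zero_mul, Real.exp_zero, one_mul] at hd
  obtain ⟨t1, t2⟩ := hnn t (hs.trans hst)
  obtain ⟨s1, s2⟩ := hnn s hs
  have hκ := sq_nonneg ‖U.comp K‖
  -- At time t the extra κ²(‖z‖² + 𝔐_z) is dropped. At time s the missing κ²(‖y‖² + 𝔐_y) is added.
  -- Only the sign of the memory energies matters, not monotonicity.
  nlinarith [mul_nonneg hκ (sq_nonneg ‖z t‖), mul_nonneg hκ t1, mul_nonneg hκ s2,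
    mul_nonneg hκ (sq_nonneg ‖y s‖)]

theorem IsWeakSolution.exponentialEstimate [CompleteSpace V] (hη : 0 ≤ η)
    (h : IsWeakSolution ι A Arc η Am U K W L z₀ y₀ z y zV yV)
    (hArc : IsBoundedReactionConvection ι Arc) {γ : ℝ} {B : V →L[ℝ] StrongDual ℝ V}
    (hB : ∀ v w, B v w = B w v) (hB0 : ∀ v, 0 ≤ B v v) (hAm : IsExponentialMemory γ B Am)
    {C ϱ : ℝ} (hC : ∀ᵐ t ∂volume.restrict (Ioi (0 : ℝ)), ∀ v, |Arc t v v| ≤ C * ‖ι v‖ * ‖v‖)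
    (hϱ : C ^ 2 + 1 + 2 * γ ≤ ϱ)
    (hK : ∀ w, ‖w‖ ^ 2 + ϱ * ‖ι w‖ ^ 2 ≤ 2 * (A w - pivot ι (U (K (ι w)))) w)
    (hL : ∀ w, ‖w‖ ^ 2 + ϱ * ‖ι w‖ ^ 2 ≤ 2 * (A w - L (W (ι w))) w) :
    ExponentialEstimate η γ B (‖U.comp K‖ ^ 2) z y zV yV := by
  have hnn := fun (t : ℝ) (ht : 0 ≤ t) =>
    And.intro (weightedEnergy_nonneg hη γ hB hB0 h.error.memLp ht)
      (weightedEnergy_nonneg hη γ hB hB0 h.state.memLp ht)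
  have hI : ∀ g : ℝ → V, (∀ T : ℝ, 0 < T → MemLp g 2 (volume.restrict (Ioo 0 T))) →
      ∀ s t : ℝ, 0 ≤ s → s ≤ t →
      2 * ∫ τ in s..t, Real.exp (2 * γ * τ) * (η * Am.toFun g τ (g τ))
        = weightedEnergy η γ B g t - weightedEnergy η γ B g s := by
    intro g hg s t hs hst
    have h1 : ∫ τ in s..t, Real.exp (2 * γ * τ) * (η * Am.toFun g τ (g τ))
        = ∫ τ in s..t, η * weightedPower γ B g τ := by
      refine intervalIntegral.integral_congr_ae (Eventually.of_forall fun τ hτ => ?_)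
      rw [uIoc_of_le hst] at hτ
      have hτ0 : 0 < τ := hs.trans_lt hτ.1
      rw [hAm.weightedPower_eq hτ0 (hg τ hτ0)]
      ring
    rw [h1, intervalIntegral.integral_const_mul, ← intervalIntegral.integral_interval_sub_left
      (intervalIntegrable_weightedPower γ B hg le_rfl (hs.trans hst))
      (intervalIntegrable_weightedPower γ B hg le_rfl hs)]
    simp only [weightedEnergy]
    ring
  have hbound : ∀ s t : ℝ, 0 ≤ s → s ≤ t →
      Real.exp (2 * γ * t) * (‖z t‖ ^ 2 + ‖y t‖ ^ 2)
        + (weightedEnergy η γ B zV t + weightedEnergy η γ B yV t)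
      ≤ (1 + ‖U.comp K‖ ^ 2) * (Real.exp (2 * γ * s) * (‖z s‖ ^ 2 + ‖y s‖ ^ 2)
        + (weightedEnergy η γ B zV s + weightedEnergy η γ B yV s)) := by
    intro s t hs hst
    have hd := h.weighted_dissipation hArc hC hϱ hK hL hs hst
    have hz := hI zV h.error.memLp s t hs hst
    have hy := hI yV h.state.memLp s t hs hst
    obtain ⟨t1, t2⟩ := hnn t (hs.trans hst)
    obtain ⟨s1, s2⟩ := hnn s hs
    have hκ := sq_nonneg ‖U.comp K‖
    have e1 := mul_nonneg (Real.exp_pos (2 * γ * t)).le (mul_nonneg hκ (sq_nonneg ‖z t‖))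
    have e2 := mul_nonneg (Real.exp_pos (2 * γ * s)).le (mul_nonneg hκ (sq_nonneg ‖y s‖))
    nlinarith [mul_nonneg hκ t1, mul_nonneg hκ s2]
  refine ⟨fun t ht => ⟨intervalIntegrable_weightedPower γ B h.error.memLp le_rfl ht,
    intervalIntegrable_weightedPower γ B h.state.memLp le_rfl ht⟩, hnn, hbound, fun t ht => ?_⟩
  have hb := hbound 0 t le_rfl ht
  obtain ⟨t1, t2⟩ := hnn t ht
  -- The weighted energies vanish at time 0, and the energy at time t is discarded by its sign.
  simp only [weightedEnergy, intervalIntegral.integral_same, mul_zero, add_zero, Real.exp_zero,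
    one_mul] at hb t1 t2
  have hexp : Real.exp (-2 * γ * t) * Real.exp (2 * γ * t) = 1 := by
    rw [← Real.exp_add, ← Real.exp_zero]
    congr 1
    ring
  have hle : Real.exp (2 * γ * t) * (‖z t‖ ^ 2 + ‖y t‖ ^ 2)
      ≤ (1 + ‖U.comp K‖ ^ 2) * (‖z 0‖ ^ 2 + ‖y 0‖ ^ 2) := by linarith
  calc ‖z t‖ ^ 2 + ‖y t‖ ^ 2
      = Real.exp (-2 * γ * t) * (Real.exp (2 * γ * t) * (‖z t‖ ^ 2 + ‖y t‖ ^ 2)) := by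
        rw [← mul_assoc, hexp, one_mul]
    _ ≤ Real.exp (-2 * γ * t) * ((1 + ‖U.comp K‖ ^ 2) * (‖z 0‖ ^ 2 + ‖y 0‖ ^ 2)) :=
        mul_le_mul_of_nonneg_left hle (Real.exp_pos _).le
    _ = _ := by ring

end Estimates

end MemoryStab

/-! ### Choice of the thresholds -/

theorem theorem3p1
    {V H : Type*}
    [NormedAddCommGroup V] [InnerProductSpace ℝ V] [CompleteSpace V]
    [TopologicalSpace.SeparableSpace V]
    [NormedAddCommGroup H] [InnerProductSpace ℝ H] [CompleteSpace H]
    [TopologicalSpace.SeparableSpace H]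
    (ι : V →L[ℝ] H) (hι : MemoryStab.IsGelfandInclusion ι)
    (A : V →L[ℝ] StrongDual ℝ V) (hA : MemoryStab.IsCompleteScalarProduct A)
    (Arc : ℝ → V →L[ℝ] StrongDual ℝ V) (hArc : MemoryStab.IsBoundedReactionConvection ι Arc)
    (σ ς : ℕ+ → ℕ)
    (act : (M : ℕ+) → Fin (σ M) → H) (sens : (S : ℕ+) → Fin (ς S) → H)
    (K : (M : ℕ+) → ℝ≥0 → H →L[ℝ] EuclideanSpace ℝ (Fin (σ M)))
    (L : (S : ℕ+) → ℝ≥0 → EuclideanSpace ℝ (Fin (ς S)) →L[ℝ] StrongDual ℝ V)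
    (hK : MemoryStab.IsEventuallyCoercive ι A
      (fun M l w => MemoryStab.pivot ι (MemoryStab.inputOp (act M) (K M l (ι w)))))
    (hL : MemoryStab.IsEventuallyCoercive ι A
      (fun S l w => L S l (MemoryStab.outputOp (sens S) (ι w))))
    (η : ℝ) (hη : 0 ≤ η)
    (Am : MemoryStab.HistoryOperator V) (hAm : MemoryStab.IsPositiveMemory Am) :
    ∃ Ms Ss : ℕ+,
      (∃ ls₁ ls₂ : ℕ+ → ℝ≥0,
        ∀ M ≥ Ms, ∀ S ≥ Ss, ∀ l₁ ≥ ls₁ M, ∀ l₂ ≥ ls₂ S,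
          ∃ D : ℝ, 0 ≤ D ∧
            ∀ (z₀ y₀ : H) (z y : ℝ → H) (zV yV : ℝ → V),
              MemoryStab.IsWeakSolution ι A Arc η Am
                (MemoryStab.inputOp (act M)) (K M l₁) (MemoryStab.outputOp (sens S)) (L S l₂)
                z₀ y₀ z y zV yV →
              MemoryStab.LyapunovEstimate η Am D z y zV yV) ∧
      (∀ (γ : ℝ) (B : V →L[ℝ] StrongDual ℝ V),
        0 < γ → (∀ v w, B v w = B w v) → (∀ v, 0 ≤ B v v) →
        MemoryStab.IsExponentialMemory γ B Am →
        ∃ Ms' ≥ Ms, ∃ Ss' ≥ Ss, ∃ ls₁ ls₂ : ℕ+ → ℝ≥0,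
          ∀ M ≥ Ms', ∀ S ≥ Ss', ∀ l₁ ≥ ls₁ M, ∀ l₂ ≥ ls₂ S,
            ∃ D : ℝ, 0 ≤ D ∧
              ∀ (z₀ y₀ : H) (z y : ℝ → H) (zV yV : ℝ → V),
                MemoryStab.IsWeakSolution ι A Arc η Am
                  (MemoryStab.inputOp (act M)) (K M l₁) (MemoryStab.outputOp (sens S)) (L S l₂)
                  z₀ y₀ z y zV yV →
                MemoryStab.LyapunovEstimate η Am D z y zV yV ∧
                MemoryStab.ExponentialEstimate η γ B D z y zV yV) := by
  obtain ⟨C, hC⟩ := hArc.exists_bound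
  have h0 : 0 < C ^ 2 + 1 := by positivity
  obtain ⟨Ms, ls₁, h₁⟩ := hK.exists_thresholds h0
  obtain ⟨Ss, ls₂, h₂⟩ := hL.exists_thresholds h0
  refine ⟨Ms, Ss, ⟨ls₁, ls₂, fun M hM S hS l₁ hl₁ l₂ hl₂ =>
      ⟨‖(MemoryStab.inputOp (act M)).comp (K M l₁)‖ ^ 2, sq_nonneg _, ?_⟩⟩, ?_⟩
  · intro z₀ y₀ z y zV yV h
    exact h.lyapunovEstimate hη hAm hArc hC le_rfl (h₁ M hM l₁ hl₁) (h₂ S hS l₂ hl₂)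
  · intro γ B hγ hB hB0 hexp
    have hγ0 : 0 < C ^ 2 + 1 + 2 * γ := by positivity
    obtain ⟨Ms', ls₁', h₁'⟩ := hK.exists_thresholds hγ0
    obtain ⟨Ss', ls₂', h₂'⟩ := hL.exists_thresholds hγ0
    -- The maxima only secure `Ms ≤ Ms'` and `Ss ≤ Ss'`. The gains chosen for the larger ϱ also
    -- serve the unweighted estimate, which needs just C² + 1 ≤ ϱ, with the same constant.
    refine ⟨max Ms Ms', le_max_left _ _, max Ss Ss', le_max_left _ _, ls₁', ls₂',
      fun M hM S hS l₁ hl₁ l₂ hl₂ =>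
      ⟨‖(MemoryStab.inputOp (act M)).comp (K M l₁)‖ ^ 2, sq_nonneg _, ?_⟩⟩
    intro z₀ y₀ z y zV yV h
    have hKM := h₁' M ((le_max_right _ _).trans hM) l₁ hl₁
    have hLS := h₂' S ((le_max_right _ _).trans hS) l₂ hl₂
    exact ⟨h.lyapunovEstimate hη hAm hArc hC (by linarith) hKM hLS,
      h.exponentialEstimate hη hArc hB hB0 hexp hC le_rfl hKM hLS⟩
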